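/- Let $R$ be a commutative ring. Let $W_{\infty\infty}$ be the poset of shuffle words: finite words in the letters $a_1,a_2,\dots$ (lower alphabet) and $x_1,x_2,\dots$ (upper alphabet) in which the letters of each alphabet occur with strictly increasing subscripts, ordered by $u\le w$ iff $w$ is obtained from $u$ by a finite sequence of steps through shuffle words, each of which deletes one letter $a_i$ or inserts one letter $x_j$. For $u\le w$, the letters common to $u$ and $w$ occur in the same order in both; they cut $u$ into consecutive, possibly empty factors of lengths $m_0,\dots,m_t$ and $w$ into factors of lengths $n_0,\dots,n_t$. The list $(m_0,n_0),\dots,(m_t,n_t)$ is called the canonical type of $[u,w]$. For an $R$-valued function $f$ on the intervals of $W_{\infty\infty}$ put $f_{ij}=f(a_1\cdots a_i,\;x_1\cdots x_j)$. Call $f$ multiplicative if $f_{00}=1$ and $f(u,w)=\prod_{p=0}^{t} f_{m_pn_p}$ for every interval $[u,w]$ of canonical type $(m_0,n_0),\dots,(m_t,n_t)$. Let $*$ be the convolution $(f*g)(u,w)=\sum_{u\le v\le w}f(u,v)g(v,w)$ of the incidence algebra of $W_{\infty\infty}$ over $R$. **Theorem 5.2.** The multiplicative functions form a submonoid of the incidence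 algebra under $*$ (the identity element is multiplicative, and $f*g$ is multiplicative if $f$ and $g$ are), and $f\mapsto\sum_{i,j\ge0}f_{ij}x^iy^j$ is a bijection from the multiplicative functions onto the power series in $R[[x,y]]$ with constant term $1$. This monoid is described as follows. Let $f,g$ be multiplicative, let $F=\sum f_{ij}x^iy^j$, $G=\sum g_{ij}x^iy^j$ and $F*G=\sum (f*g)_{ij}x^iy^j$, and put $F_0=F(x,0)$, $G_0=G(0,y)$, $\tilde F=F(x,G_0y)$ and $\tilde G=G(F_0x,y)$. Then $F*G,\tilde F,\tilde G,F_0,G_0$ are invertible in $R[[x,y]]$, and $$\frac1{F*G}=\frac1{\tilde F\,G_0}+\frac1{F_0\,\tilde G}-\frac1{F_0G_0}.$$ -/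

import Mathlib

/-- A letter: `lower i` is the letter `a_{i+1}` of the infinite lower alphabet, and `upper j`
is the letter `x_{j+1}` of the infinite upper alphabet. -/
inductive ShuffleLetter : Type
  | lower (i : ℕ) : ShuffleLetter
  | upper (j : ℕ) : ShuffleLetter
  deriving DecidableEq

namespace ShuffleLetter

/-- The subscript of a letter of the lower alphabet. -/
def lowerIndex : ShuffleLetter → Option ℕ
  | lower i => some i
  | upper _ => none

/-- The subscript of a letter of the upper alphabet. -/
def upperIndex : ShuffleLetter → Option ℕ
  | lower _ => none
  | upper j => some j

end ShuffleLetter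

/-- A shuffle word: a finite word in the two alphabets in which the letters of either alphabet
appear with strictly increasing subscripts (in particular all letters are distinct). -/
@[ext]
structure ShuffleWord where
  letters : List ShuffleLetter
  lower_increasing : (letters.filterMap ShuffleLetter.lowerIndex).Pairwise (· < ·)
  upper_increasing : (letters.filterMap ShuffleLetter.upperIndex).Pairwise (· < ·)

namespace ShuffleWord

instance instDecidableEq : DecidableEq ShuffleWord := fun u w =>
  decidable_of_iff (u.letters = w.letters) ⟨ShuffleWord.ext, congrArg letters⟩

/-- `Step u w`: the shuffle word `w` is obtained from the shuffle word `u` by deleting one letter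
of the lower alphabet or by inserting one letter of the upper alphabet. -/
def Step (u w : ShuffleWord) : Prop :=
  (∃ (l r : List ShuffleLetter) (i : ℕ), u.letters = l ++ ShuffleLetter.lower i :: r ∧ w.letters = l ++ r) ∨
  (∃ (l r : List ShuffleLetter) (j : ℕ), u.letters = l ++ r ∧ w.letters = l ++ ShuffleLetter.upper j :: r)

/-- The number of upper letters minus the number of lower letters. -/
def height (u : ShuffleWord) : ℤ :=
  ((u.letters.filterMap ShuffleLetter.upperIndex).length : ℤ) -
    ((u.letters.filterMap ShuffleLetter.lowerIndex).length : ℤ)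

theorem Step.height_lt {u w : ShuffleWord} (h : Step u w) : u.height < w.height := by
  rcases h with ⟨l, r, i, hu, hw⟩ | ⟨l, r, j, hu, hw⟩ <;>
    simp only [height, hu, hw, List.filterMap_append, List.filterMap_cons,
      ShuffleLetter.lowerIndex, ShuffleLetter.upperIndex, List.length_append, List.length_cons] <;>
    push_cast <;> omega

theorem height_le_of_chain {u w : ShuffleWord} (h : Relation.ReflTransGen Step u w) :
    u = w ∨ u.height < w.height := by
  induction h with
  | refl => exact Or.inl rfl
  | tail _ hs ih =>
    rcases ih with rfl | ih
    · exact Or.inr hs.height_lt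
    · exact Or.inr (ih.trans hs.height_lt)

/-- The poset of shuffles over the two infinite alphabets: the order is generated by the steps. -/
instance instPartialOrder : PartialOrder ShuffleWord where
  le := Relation.ReflTransGen Step
  le_refl _ := Relation.ReflTransGen.refl
  le_trans _ _ _ := Relation.ReflTransGen.trans
  le_antisymm u w h₁ h₂ := by
    rcases height_le_of_chain h₁ with h | h
    · exact h
    · rcases height_le_of_chain h₂ with h' | h'
      · exact h'.symm
      · exact absurd (h.trans h') (lt_irrefl _)

theorem le_iff {u w : ShuffleWord} : u ≤ w ↔ Relation.ReflTransGen Step u w := Iff.rfl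

theorem nodup (u : ShuffleWord) : u.letters.Nodup := by
  have h₁ := List.pairwise_filterMap.1 u.lower_increasing
  have h₂ := List.pairwise_filterMap.1 u.upper_increasing
  refine (h₁.and h₂).imp ?_
  rintro (i | j) b ⟨h, h'⟩ rfl
  · exact lt_irrefl _ (h i rfl i rfl)
  · exact lt_irrefl _ (h' j rfl j rfl)

theorem mem_lower_of_le {u w : ShuffleWord} (h : u ≤ w) {i : ℕ}
    (hi : ShuffleLetter.lower i ∈ w.letters) : ShuffleLetter.lower i ∈ u.letters := by
  rw [le_iff] at h
  induction h with
  | refl => exact hi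
  | tail _ hs ih =>
    apply ih
    rcases hs with ⟨l, r, k, hu, hw⟩ | ⟨l, r, k, hu, hw⟩ <;>
      (rw [hw] at hi; rw [hu]; simp at hi ⊢; tauto)

theorem mem_upper_of_le {u w : ShuffleWord} (h : u ≤ w) {j : ℕ}
    (hj : ShuffleLetter.upper j ∈ u.letters) : ShuffleLetter.upper j ∈ w.letters := by
  rw [le_iff] at h
  induction h with
  | refl => exact hj
  | tail _ hs ih =>
    rcases hs with ⟨l, r, k, hu, hw⟩ | ⟨l, r, k, hu, hw⟩ <;>
      (rw [hu] at ih; rw [hw]; simp at ih ⊢; tauto)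

theorem finite_Icc (u w : ShuffleWord) : (Set.Icc u w).Finite := by
  have hfin : {l : List ShuffleLetter | l.Subperm (u.letters ++ w.letters)}.Finite := by
    refine (List.finite_toSet ((u.letters ++ w.letters).sublists.flatMap List.permutations)).subset ?_
    rintro l ⟨l', hp, hs⟩
    simp only [Set.mem_ofPred_eq, List.mem_flatMap, List.mem_sublists, List.mem_permutations]
    exact ⟨l', hs, hp.symm⟩
  refine (hfin.preimage (f := letters) (fun a _ b _ h => ShuffleWord.ext h)).subset ?_
  rintro v ⟨h₁, h₂⟩
  refine v.nodup.subperm ?_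
  rintro (i | j) hv
  · exact List.mem_append_left _ (mem_lower_of_le h₁ hv)
  · exact List.mem_append_right _ (mem_upper_of_le h₂ hv)

/-- Every interval is finite, so that the incidence algebra, with convolution as its product, is
available. -/
noncomputable instance instLocallyFiniteOrder : LocallyFiniteOrder ShuffleWord :=
  LocallyFiniteOrder.ofFiniteIcc finite_Icc

/-- The canonical isomorphism type of an interval `[u, w]`. The letters common to `u` and `w` cut
`u` into consecutive (possibly empty) factors of lengths `m₀, …, m_t` and `w` into consecutive
factors of lengths `n₀, …, n_t`; the type is the list of the pairs `(m_p, n_p)`, which stands for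
the product of the posets of shuffles `W_{m_p n_p}`. -/
def canonicalType (u w : ShuffleWord) : List (ℕ × ℕ) :=
  List.zip ((u.letters.splitOnP (fun c => decide (c ∈ w.letters))).map List.length)
    ((w.letters.splitOnP (fun c => decide (c ∈ u.letters))).map List.length)

/-- The word `a_1 a_2 ⋯ a_m`. -/
def lowerWord (m : ℕ) : ShuffleWord where
  letters := (List.range m).map ShuffleLetter.lower
  lower_increasing := by
    simpa [List.filterMap_map, Function.comp_def, ShuffleLetter.lowerIndex,
      ShuffleLetter.upperIndex] using List.pairwise_lt_range (n := m)
  upper_increasing := by simp [List.filterMap_map, Function.comp_def, ShuffleLetter.upperIndex]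

/-- The word `x_1 x_2 ⋯ x_n`. -/
def upperWord (n : ℕ) : ShuffleWord where
  letters := (List.range n).map ShuffleLetter.upper
  lower_increasing := by simp [List.filterMap_map, Function.comp_def, ShuffleLetter.lowerIndex]
  upper_increasing := by
    simpa [List.filterMap_map, Function.comp_def, ShuffleLetter.lowerIndex,
      ShuffleLetter.upperIndex] using List.pairwise_lt_range (n := n)

variable {R : Type*} [CommRing R]

/-- The value `f_{mn}` of `f` on the interval `[a_1 ⋯ a_m, x_1 ⋯ x_n] = W_{mn}`. -/
def entry (f : IncidenceAlgebra R ShuffleWord) (m n : ℕ) : R :=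
  f (lowerWord m) (upperWord n)

/-- A function `f` on the intervals is multiplicative if `f_{00} = 1` and `f(u, w)` is the product
of the values `f_{mn}` over the factors `W_{mn}` in the canonical isomorphism type of `[u, w]`. -/
def IsMultiplicative (f : IncidenceAlgebra R ShuffleWord) : Prop :=
  entry f 0 0 = 1 ∧
    ∀ u w : ShuffleWord, u ≤ w →
      f u w = ((canonicalType u w).map (fun p => entry f p.1 p.2)).prod

/-- The generating series `∑ f_{ij} x^i y^j`, with `x = X 0` and `y = X 1`. -/
def genSeries (f : IncidenceAlgebra R ShuffleWord) : MvPowerSeries (Fin 2) R :=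
  fun d => entry f (d 0) (d 1)

end ShuffleWord

/-! Words are compared through a relation on lists, `ListLE`, read off from the left. A letter
common to `u` and `w` lies in every `v` between them and cuts the interval into a product of two
intervals. Hence the convolution of two multiplicative functions factors at common letters
(`mul_apply_split`), and only intervals without common letters remain, where `u` has lower and `w`
upper letters only.

On such an interval the sum of `f(u,v) g(v,w)` is evaluated by reading `v` from left to right. A
lower letter of `v` closes a factor of the type of `[u,v]`, an upper letter closes a factor of the
type of `[v,w]`. All that must be remembered is the number `a` of lower letters since the last upper
one and the number `b` of upper letters since the last lower one. This gives the recursion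
`convCoeff` (`sum_weight_shuffles`). It involves only lengths, so `f * g` is multiplicative.

Let `P a b` be the generating series of `convCoeff` in state `(a, b)`, let `F_b(x)` be the
coefficient of `y^b` in `F`, and `G_a(y)` that of `x^a` in `G`. The recursion becomes `P a b = F_b
G_a + x F_b P (a+1) 0 + y G_a P 0 (b+1)`. Iterating it along `b = 0` gives `P 0 0 = G̃ (F_0 + y P 0
1)`, and along `a = 0` it gives `P 0 0 = F̃ (G_0 + x P 1 0)`. The case `a = b = 0` says that `P 0 0
= F_0 (G_0 + x P 1 0) + G_0 (F_0 + y P 0 1) - F_0 G_0`. Dividing by `P 0 0 F_0 G_0` yields the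
formula. -/

namespace ShuffleWord

/-! ### The order on words as a relation on lists, and canonical types -/

open ShuffleLetter

/-- The relation on lists of letters generated by deleting lower and inserting upper letters. -/
inductive ListLE : List ShuffleLetter → List ShuffleLetter → Prop
  | nil : ListLE [] []
  | cons (c : ShuffleLetter) {u w : List ShuffleLetter} : ListLE u w → ListLE (c :: u) (c :: w)
  | del (i : ℕ) {u w : List ShuffleLetter} : ListLE u w → ListLE (lower i :: u) w
  | ins (j : ℕ) {u w : List ShuffleLetter} : ListLE u w → ListLE u (upper j :: w)

namespace ListLE

theorem refl (u : List ShuffleLetter) : ListLE u u := by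
  induction u with
  | nil => exact nil
  | cons c u ih => exact ih.cons c

theorem append {u₁ w₁ u₂ w₂ : List ShuffleLetter} (h₁ : ListLE u₁ w₁) (h₂ : ListLE u₂ w₂) :
    ListLE (u₁ ++ u₂) (w₁ ++ w₂) := by
  induction h₁ with
  | nil => exact h₂
  | cons c _ ih => exact ih.cons c
  | del i _ ih => exact ih.del i
  | ins j _ ih => exact ih.ins j

/-- Chains of steps grow at their upper end, whereas `ListLE` is built from the first letter. This
lemma and `insert_right` absorb one further step. -/
theorem delete_right {i : ℕ} {u v : List ShuffleLetter} (h : ListLE u v) :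
    ∀ {l r : List ShuffleLetter}, v = l ++ lower i :: r → ListLE u (l ++ r) := by
  induction h with
  | nil => intro l r h; simp at h
  | @cons c u w h ih =>
    intro l r hv
    cases l with
    | nil =>
      simp only [List.nil_append, List.cons.injEq] at hv
      obtain ⟨rfl, rfl⟩ := hv
      exact h.del i
    | cons d l =>
      simp only [List.cons_append, List.cons.injEq] at hv
      obtain ⟨rfl, rfl⟩ := hv
      exact (ih rfl).cons c
  | del k _ ih => intro l r hv; exact (ih hv).del k
  | @ins j u w h ih =>
    intro l r hv
    cases l with
    | nil => simp at hv
    | cons d l =>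
      simp only [List.cons_append, List.cons.injEq] at hv
      obtain ⟨rfl, rfl⟩ := hv
      exact (ih rfl).ins j

theorem insert_right {j : ℕ} {u v : List ShuffleLetter} (h : ListLE u v) :
    ∀ {l r : List ShuffleLetter}, v = l ++ r → ListLE u (l ++ upper j :: r) := by
  induction h with
  | nil =>
    intro l r hv
    obtain ⟨rfl, rfl⟩ := List.append_eq_nil_iff.1 hv.symm
    exact nil.ins j
  | @cons c u w h ih =>
    intro l r hv
    cases l with
    | nil =>
      simp only [List.nil_append] at hv
      subst hv
      exact (h.cons c).ins j
    | cons d l =>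
      simp only [List.cons_append, List.cons.injEq] at hv
      obtain ⟨rfl, rfl⟩ := hv
      exact (ih rfl).cons c
  | del k _ ih => intro l r hv; exact (ih hv).del k
  | @ins k u w h ih =>
    intro l r hv
    cases l with
    | nil =>
      simp only [List.nil_append] at hv
      subst hv
      exact (h.ins k).ins j
    | cons d l =>
      simp only [List.cons_append, List.cons.injEq] at hv
      obtain ⟨rfl, rfl⟩ := hv
      exact (ih rfl).ins k

theorem lower_mem {u w : List ShuffleLetter} (h : ListLE u w) {i : ℕ} (hi : lower i ∈ w) :
    lower i ∈ u := by
  induction h <;> simp_all; tauto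

theorem upper_mem {u w : List ShuffleLetter} (h : ListLE u w) {j : ℕ} (hj : upper j ∈ u) :
    upper j ∈ w := by
  induction h <;> simp_all; tauto

/-- Since letters do not repeat, the two occurrences of `c` can only be matched with each other by a
`cons`, and the derivation breaks there. -/
theorem split {c : ShuffleLetter} {u w : List ShuffleLetter} (h : ListLE u w) :
    ∀ {u₁ u₂ w₁ w₂ : List ShuffleLetter}, u = u₁ ++ c :: u₂ → w = w₁ ++ c :: w₂ →
      u.Nodup → w.Nodup → ListLE u₁ w₁ ∧ ListLE u₂ w₂ := by
  induction h with
  | nil => intro u₁ u₂ w₁ w₂ hu; simp at hu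
  | @cons d u w h ih =>
    intro u₁ u₂ w₁ w₂ hu hw nu nw
    rcases u₁ with _ | ⟨a, u₁⟩ <;> rcases w₁ with _ | ⟨b, w₁⟩ <;>
      simp only [List.nil_append, List.cons_append, List.cons.injEq] at hu hw <;>
      obtain ⟨rfl, rfl⟩ := hu <;> obtain ⟨h', rfl⟩ := hw
    · exact ⟨nil, h⟩
    · subst h'; simp at nw
    · subst h'; simp at nu
    · subst h'
      obtain ⟨h₁, h₂⟩ := ih rfl rfl nu.of_cons nw.of_cons
      exact ⟨h₁.cons _, h₂⟩
  | @del i u w h ih =>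
    intro u₁ u₂ w₁ w₂ hu hw nu nw
    rcases u₁ with _ | ⟨a, u₁⟩ <;>
      simp only [List.nil_append, List.cons_append, List.cons.injEq] at hu <;>
      obtain ⟨rfl, rfl⟩ := hu
    -- The deleted letter would be `c` itself; as `c` is in `w`, it would occur once more in the
    -- rest of `u`.
    · exact absurd (h.lower_mem (i := i) (by simp [hw])) (List.nodup_cons.1 nu).1
    · obtain ⟨h₁, h₂⟩ := ih rfl hw nu.of_cons nw
      exact ⟨h₁.del _, h₂⟩
  | @ins j u w h ih =>
    intro u₁ u₂ w₁ w₂ hu hw nu nw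
    rcases w₁ with _ | ⟨a, w₁⟩ <;>
      simp only [List.nil_append, List.cons_append, List.cons.injEq] at hw <;>
      obtain ⟨rfl, rfl⟩ := hw
    · exact absurd (h.upper_mem (j := j) (by simp [hu])) (List.nodup_cons.1 nw).1
    · obtain ⟨h₁, h₂⟩ := ih hu rfl nu nw.of_cons
      exact ⟨h₁.ins _, h₂⟩

end ListLE

/-- A sublist of a shuffle word is a shuffle word. -/
def ofSublist (u : ShuffleWord) (l : List ShuffleLetter) (h : l.Sublist u.letters) :
    ShuffleWord where
  letters := l
  lower_increasing := u.lower_increasing.sublist (h.filterMap _)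
  upper_increasing := u.upper_increasing.sublist (h.filterMap _)

theorem listLE_of_le {u w : ShuffleWord} (h : u ≤ w) : ListLE u.letters w.letters := by
  rw [le_iff] at h
  induction h with
  | refl => exact ListLE.refl _
  | tail _ hs ih =>
    rcases hs with ⟨l, r, i, hu, hw⟩ | ⟨l, r, j, hu, hw⟩
    · rw [hw]; exact ih.delete_right hu
    · rw [hw]; exact ih.insert_right hu

/-- The prefix `p` holds the letters already matched. A deletion is made first in the chain and an
insertion last, so each intermediate list is a sublist of `u'` or of `w'` and therefore a shuffle
word. -/
theorem le_of_listLE_append {u w : List ShuffleLetter} (h : ListLE u w) :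
    ∀ (p : List ShuffleLetter) (u' w' : ShuffleWord), u'.letters = p ++ u → w'.letters = p ++ w →
      u' ≤ w' := by
  induction h with
  | nil =>
    intro p u' w' hu hw
    exact le_of_eq (ShuffleWord.ext (hu.trans hw.symm))
  | cons c _ ih =>
    intro p u' w' hu hw
    exact ih (p ++ [c]) u' w' (by simp [hu]) (by simp [hw])
  | @del i u w h ih =>
    intro p u' w' hu hw
    let v : ShuffleWord := u'.ofSublist (p ++ u) (by
      rw [hu]; exact (List.Sublist.refl p).append (List.sublist_cons_self _ _))
    have hs : Step u' v := Or.inl ⟨p, u, i, hu, rfl⟩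
    exact le_trans (le_iff.2 (Relation.ReflTransGen.single hs)) (ih p v w' rfl hw)
  | @ins j u w h ih =>
    intro p u' w' hu hw
    let v : ShuffleWord := w'.ofSublist (p ++ w) (by
      rw [hw]; exact (List.Sublist.refl p).append (List.sublist_cons_self _ _))
    have hs : Step v w' := Or.inr ⟨p, w, j, rfl, hw⟩
    exact le_trans (ih p u' v hu rfl) (le_iff.2 (Relation.ReflTransGen.single hs))

theorem le_iff_listLE {u w : ShuffleWord} : u ≤ w ↔ ListLE u.letters w.letters :=
  ⟨listLE_of_le, fun h => le_of_listLE_append h [] u w rfl rfl⟩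

theorem shuffle_of_between {u v w : List ShuffleLetter} (h : ListLE u v) (h' : ListLE v w) :
    (v.filterMap lowerIndex).Sublist (u.filterMap lowerIndex) ∧
      (v.filterMap upperIndex).Sublist (w.filterMap upperIndex) := by
  constructor
  · clear h'
    induction h with
    | nil => simp
    | cons c _ ih => rcases c with i | j <;> simpa [List.filterMap_cons, lowerIndex] using ih
    | del i _ ih => simpa [List.filterMap_cons, lowerIndex] using ih.cons i
    | ins j _ ih => simpa [List.filterMap_cons, lowerIndex] using ih
  · clear h
    induction h' with
    | nil => simp
    | cons c _ ih => rcases c with i | j <;> simpa [List.filterMap_cons, upperIndex] using ih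
    | del i _ ih => simpa [List.filterMap_cons, upperIndex] using ih
    | ins j _ ih => simpa [List.filterMap_cons, upperIndex] using ih.cons j

/-- A list between two shuffle words is a shuffle word. -/
def ofBetween (u w : ShuffleWord) (v : List ShuffleLetter) (h : ListLE u.letters v)
    (h' : ListLE v w.letters) : ShuffleWord where
  letters := v
  lower_increasing := u.lower_increasing.sublist (shuffle_of_between h h').1
  upper_increasing := w.upper_increasing.sublist (shuffle_of_between h h').2

/-- The canonical type of a pair of lists of letters. -/
def listType (u w : List ShuffleLetter) : List (ℕ × ℕ) :=
  List.zip ((u.splitOnP (fun c => decide (c ∈ w))).map List.length)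
    ((w.splitOnP (fun c => decide (c ∈ u))).map List.length)

theorem splitOnP_congr {α : Type*} {p q : α → Bool} {l : List α} (h : ∀ x ∈ l, p x = q x) :
    l.splitOnP p = l.splitOnP q := by
  induction l with
  | nil => simp
  | cons a l ih =>
    simp only [List.mem_cons, forall_eq_or_imp] at h
    simp only [List.splitOnP_cons_eq_if_modifyHead, h.1, ih h.2]

theorem length_splitOnP {α : Type*} (p : α → Bool) (l : List α) :
    (l.splitOnP p).length = l.countP p + 1 := by
  induction l with
  | nil => simp
  | cons a l ih =>
    rw [List.splitOnP_cons_eq_if_modifyHead, List.countP_cons]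
    split <;> simp_all

theorem listType_of_disjoint {u w : List ShuffleLetter} (h : u.Disjoint w) :
    listType u w = [(u.length, w.length)] := by
  rw [listType, List.splitOnP_eq_singleton, List.splitOnP_eq_singleton]
  · simp
  · intro x hx; simpa using fun hx' => h hx' hx
  · intro x hx; simpa using fun hx' => h hx hx'

/-- Equal numbers of common letters to the left of `c` keep the two lists of factors aligned under
`zip`. Neither `ListLE` nor distinctness is assumed, so that the lemma also serves when letters
already read are prepended to a word. -/
theorem listType_append_cons_of_length {c : ShuffleLetter} {u₁ u₂ w₁ w₂ : List ShuffleLetter}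
    (hu₁ : ∀ x ∈ u₁, x ∈ w₁ ++ c :: w₂ ↔ x ∈ w₁) (hu₂ : ∀ x ∈ u₂, x ∈ w₁ ++ c :: w₂ ↔ x ∈ w₂)
    (hw₁ : ∀ x ∈ w₁, x ∈ u₁ ++ c :: u₂ ↔ x ∈ u₁) (hw₂ : ∀ x ∈ w₂, x ∈ u₁ ++ c :: u₂ ↔ x ∈ u₂)
    (hl : u₁.countP (fun c => decide (c ∈ w₁)) = w₁.countP (fun c => decide (c ∈ u₁))) :
    listType (u₁ ++ c :: u₂) (w₁ ++ c :: w₂) = listType u₁ w₁ ++ listType u₂ w₂ := by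
  rw [listType, List.splitOnP_append_cons _ _ (by simp), List.splitOnP_append_cons _ _ (by simp),
    splitOnP_congr (l := u₁) fun x hx => decide_eq_decide.2 (hu₁ x hx),
    splitOnP_congr (l := u₂) fun x hx => decide_eq_decide.2 (hu₂ x hx),
    splitOnP_congr (l := w₁) fun x hx => decide_eq_decide.2 (hw₁ x hx),
    splitOnP_congr (l := w₂) fun x hx => decide_eq_decide.2 (hw₂ x hx),
    List.map_append, List.map_append, List.zip_append (by simp [length_splitOnP, hl])]
  rfl

theorem countP_mem_comm {α : Type*} [DecidableEq α] {u w : List α} (hu : u.Nodup) (hw : w.Nodup) :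
    u.countP (fun c => decide (c ∈ w)) = w.countP (fun c => decide (c ∈ u)) := by
  rw [List.countP_eq_length_filter, List.countP_eq_length_filter]
  exact ((List.perm_ext_iff_of_nodup (hu.filter _) (hw.filter _)).2
    fun a => by simp [and_comm]).length_eq

theorem listType_append_cons {c : ShuffleLetter} {u₁ u₂ w₁ w₂ : List ShuffleLetter}
    (h₁ : ListLE u₁ w₁) (h₂ : ListLE u₂ w₂) (hu : (u₁ ++ c :: u₂).Nodup)
    (hw : (w₁ ++ c :: w₂).Nodup) :
    listType (u₁ ++ c :: u₂) (w₁ ++ c :: w₂) = listType u₁ w₁ ++ listType u₂ w₂ := by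
  simp only [List.nodup_append', List.nodup_cons, List.disjoint_cons_right] at hu hw
  obtain ⟨nu₁, ⟨cu₂, nu₂⟩, cu₁, du⟩ := hu
  obtain ⟨nw₁, ⟨cw₂, nw₂⟩, cw₁, dw⟩ := hw
  have huw : ∀ x ∈ u₁, x ∉ w₂ := by
    rintro (i | j) hx hx'
    · exact du hx (h₂.lower_mem hx')
    · exact dw (h₁.upper_mem hx) hx'
  have hwu : ∀ x ∈ w₁, x ∉ u₂ := by
    rintro (i | j) hx hx'
    · exact du (h₁.lower_mem hx) hx'
    · exact dw hx (h₂.upper_mem hx')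
  apply listType_append_cons_of_length
  · intro x hx
    have : x ≠ c := by rintro rfl; exact cu₁ hx
    simp [this, huw x hx]
  · intro x hx
    have : x ≠ c := by rintro rfl; exact cu₂ hx
    have : x ∉ w₁ := fun h => hwu x h hx
    simp [*]
  · intro x hx
    have : x ≠ c := by rintro rfl; exact cw₁ hx
    simp [this, hwu x hx]
  · intro x hx
    have : x ≠ c := by rintro rfl; exact cw₂ hx
    have : x ∉ u₁ := fun h => huw x h hx
    simp [*]
  · exact countP_mem_comm nu₁ nw₁

end ShuffleWord

/-! ### Multiplicative functions, splitting at common letters, bijection with power series -/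

namespace ShuffleWord

open ShuffleLetter

variable {R : Type*} [CommRing R]

/-- The product of the numbers `φ m n` over the canonical type of a pair of lists. -/
def weight (φ : ℕ → ℕ → R) (u w : List ShuffleLetter) : R :=
  ((listType u w).map (fun p => φ p.1 p.2)).prod

theorem weight_append_cons (φ : ℕ → ℕ → R) {c : ShuffleLetter} {u₁ u₂ w₁ w₂ : List ShuffleLetter}
    (h₁ : ListLE u₁ w₁) (h₂ : ListLE u₂ w₂) (hu : (u₁ ++ c :: u₂).Nodup)
    (hw : (w₁ ++ c :: w₂).Nodup) :
    weight φ (u₁ ++ c :: u₂) (w₁ ++ c :: w₂) = weight φ u₁ w₁ * weight φ u₂ w₂ := by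
  simp [weight, listType_append_cons h₁ h₂ hu hw]

theorem weight_of_disjoint (φ : ℕ → ℕ → R) {u w : List ShuffleLetter} (h : u.Disjoint w) :
    weight φ u w = φ u.length w.length := by
  simp [weight, listType_of_disjoint h]

theorem IsMultiplicative.apply_eq_weight {f : IncidenceAlgebra R ShuffleWord}
    (hf : IsMultiplicative f) {u w : ShuffleWord} (h : u ≤ w) :
    f u w = weight (entry f) u.letters w.letters :=
  hf.2 u w h

theorem le_and_le_of_split {c : ShuffleLetter} {u w u₁ u₂ w₁ w₂ : ShuffleWord} (h : u ≤ w)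
    (hu : u.letters = u₁.letters ++ c :: u₂.letters)
    (hw : w.letters = w₁.letters ++ c :: w₂.letters) : u₁ ≤ w₁ ∧ u₂ ≤ w₂ := by
  obtain ⟨h₁, h₂⟩ := (le_iff_listLE.1 h).split hu hw u.nodup w.nodup
  exact ⟨le_iff_listLE.2 h₁, le_iff_listLE.2 h₂⟩

theorem IsMultiplicative.apply_split {f : IncidenceAlgebra R ShuffleWord}
    (hf : IsMultiplicative f) {c : ShuffleLetter} {u w u₁ u₂ w₁ w₂ : ShuffleWord} (h : u ≤ w)
    (hu : u.letters = u₁.letters ++ c :: u₂.letters)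
    (hw : w.letters = w₁.letters ++ c :: w₂.letters) : f u w = f u₁ w₁ * f u₂ w₂ := by
  obtain ⟨h₁, h₂⟩ := le_and_le_of_split h hu hw
  rw [hf.apply_eq_weight h, hf.apply_eq_weight h₁, hf.apply_eq_weight h₂, hu, hw]
  exact weight_append_cons _ (le_iff_listLE.1 h₁) (le_iff_listLE.1 h₂) (hu ▸ u.nodup)
    (hw ▸ w.nodup)

theorem exists_split {c : ShuffleLetter} {u : ShuffleWord} (h : c ∈ u.letters) :
    ∃ u₁ u₂ : ShuffleWord, u.letters = u₁.letters ++ c :: u₂.letters := by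
  obtain ⟨l, r, hu⟩ := List.append_of_mem h
  exact ⟨u.ofSublist l (by simp [hu]),
    u.ofSublist r (by rw [hu]; exact (List.sublist_cons_self c r).trans (by simp)), hu⟩

theorem append_cons_inj {c : ShuffleLetter} {l r l' r' : List ShuffleLetter}
    (h : l ++ c :: r = l' ++ c :: r') (hn : (l ++ c :: r).Nodup) : l = l' ∧ r = r' := by
  induction l generalizing l' with
  | nil =>
    rcases l' with _ | ⟨a, l'⟩
    · simpa using h
    · simp only [List.nil_append, List.cons_append, List.cons.injEq] at h
      obtain ⟨rfl, rfl⟩ := h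
      simp at hn
  | cons a l ih =>
    rcases l' with _ | ⟨b, l'⟩
    · simp only [List.nil_append, List.cons_append, List.cons.injEq] at h
      obtain ⟨rfl, rfl⟩ := h
      simp at hn
    · simp only [List.cons_append, List.cons.injEq] at h
      obtain ⟨rfl, h⟩ := h
      obtain ⟨rfl, rfl⟩ := ih h hn.of_cons
      exact ⟨rfl, rfl⟩

/-- A function on intervals is multiplicative as soon as it splits at every common letter and
depends only on the lengths of the words when these have no letter in common. -/
theorem isMultiplicative_of_split {h : IncidenceAlgebra R ShuffleWord} (h0 : entry h 0 0 = 1)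
    (hd : ∀ u w : ShuffleWord, u ≤ w → u.letters.Disjoint w.letters →
      h u w = entry h u.letters.length w.letters.length)
    (hs : ∀ (c : ShuffleLetter) (u w u₁ u₂ w₁ w₂ : ShuffleWord), u ≤ w →
      u.letters = u₁.letters ++ c :: u₂.letters → w.letters = w₁.letters ++ c :: w₂.letters →
      h u w = h u₁ w₁ * h u₂ w₂) : IsMultiplicative h := by
  refine ⟨h0, fun u w huw => ?_⟩
  change h u w = weight (entry h) u.letters w.letters
  induction hn : u.letters.length using Nat.strong_induction_on generalizing u w with
  | _ n ih =>
    by_cases hdis : u.letters.Disjoint w.letters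
    · rw [hd u w huw hdis, weight_of_disjoint _ hdis]
    · simp only [List.Disjoint, not_forall, not_false_eq_true] at hdis
      obtain ⟨c, hcu, hcw, -⟩ := hdis
      obtain ⟨u₁, u₂, hu⟩ := exists_split hcu
      obtain ⟨w₁, w₂, hw⟩ := exists_split hcw
      obtain ⟨h₁, h₂⟩ := le_and_le_of_split huw hu hw
      have hlen := congrArg List.length hu
      simp only [List.length_append, List.length_cons] at hlen
      rw [hs c u w u₁ u₂ w₁ w₂ huw hu hw, ih _ (by omega) u₁ w₁ h₁ rfl,
        ih _ (by omega) u₂ w₂ h₂ rfl, hu, hw]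
      exact (weight_append_cons _ (le_iff_listLE.1 h₁) (le_iff_listLE.1 h₂) (hu ▸ u.nodup)
        (hw ▸ w.nodup)).symm

/-- Concatenation around `c` is a bijection from `[u₁, w₁] × [u₂, w₂]` onto `[u, w]`, and both
functions factor along it. -/
theorem IsMultiplicative.mul_apply_split {f g : IncidenceAlgebra R ShuffleWord}
    (hf : IsMultiplicative f) (hg : IsMultiplicative g)
    {c : ShuffleLetter} {u w u₁ u₂ w₁ w₂ : ShuffleWord}
    (hu : u.letters = u₁.letters ++ c :: u₂.letters)
    (hw : w.letters = w₁.letters ++ c :: w₂.letters) :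
    (f * g) u w = (f * g) u₁ w₁ * (f * g) u₂ w₂ := by
  simp only [IncidenceAlgebra.mul_apply]
  rw [Finset.sum_mul_sum, ← Finset.sum_product']
  have key : ∀ p ∈ Finset.Icc u₁ w₁ ×ˢ Finset.Icc u₂ w₂,
      ListLE u.letters (p.1.letters ++ c :: p.2.letters) ∧
        ListLE (p.1.letters ++ c :: p.2.letters) w.letters := by
    intro p hp
    simp only [Finset.mem_product, Finset.mem_Icc, le_iff_listLE] at hp
    rw [hu, hw]
    exact ⟨hp.1.1.append (hp.2.1.cons c), hp.1.2.append (hp.2.2.cons c)⟩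
  symm
  refine Finset.sum_bij
    (fun p hp => ofBetween u w (p.1.letters ++ c :: p.2.letters) (key p hp).1 (key p hp).2)
    ?_ ?_ ?_ ?_
  · intro p hp
    exact Finset.mem_Icc.2 ⟨le_iff_listLE.2 (key p hp).1, le_iff_listLE.2 (key p hp).2⟩
  · intro p hp q hq hpq
    obtain ⟨h₁, h₂⟩ := append_cons_inj (congrArg letters hpq)
      (ofBetween u w (p.1.letters ++ c :: p.2.letters) (key p hp).1 (key p hp).2).nodup
    exact Prod.ext (ShuffleWord.ext h₁) (ShuffleWord.ext h₂)
  · intro v hv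
    rw [Finset.mem_Icc] at hv
    -- Going up, lower letters are never created and upper letters never lost, so a letter at both
    -- ends is in between.
    have hc : c ∈ v.letters := by
      rcases c with i | j
      · exact mem_lower_of_le hv.2 (by simp [hw])
      · exact mem_upper_of_le hv.1 (by simp [hu])
    obtain ⟨v₁, v₂, hv'⟩ := exists_split hc
    obtain ⟨h₁, h₂⟩ := le_and_le_of_split hv.1 hu hv'
    obtain ⟨h₃, h₄⟩ := le_and_le_of_split hv.2 hv' hw
    exact ⟨(v₁, v₂), by simp [*], ShuffleWord.ext hv'.symm⟩
  · intro p hp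
    rw [hf.apply_split (w := ofBetween u w _ (key p hp).1 (key p hp).2)
        (le_iff_listLE.2 (key p hp).1) hu rfl,
      hg.apply_split (u := ofBetween u w _ (key p hp).1 (key p hp).2)
        (le_iff_listLE.2 (key p hp).2) rfl hw]
    ring

theorem eq_lower_of_disjoint {u w : List ShuffleLetter} (h : ListLE u w) (hd : u.Disjoint w) :
    (∀ c ∈ u, ∃ i, c = lower i) ∧ ∀ c ∈ w, ∃ j, c = upper j := by
  constructor
  · rintro (i | j) hc
    · exact ⟨i, rfl⟩
    · exact absurd (h.upper_mem hc) (hd hc)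
  · rintro (i | j) hc
    · exact absurd hc (hd (h.lower_mem hc))
    · exact ⟨j, rfl⟩

theorem listLE_of_lower_of_upper {u w : List ShuffleLetter} (hu : ∀ c ∈ u, ∃ i, c = lower i)
    (hw : ∀ c ∈ w, ∃ j, c = upper j) : ListLE u w := by
  induction u with
  | nil =>
    induction w with
    | nil => exact .nil
    | cons c w ih =>
      obtain ⟨j, rfl⟩ := hw c (by simp)
      exact (ih fun c hc => hw c (by simp [hc])).ins j
  | cons c u ih =>
    obtain ⟨i, rfl⟩ := hu c (by simp)
    exact (ih fun c hc => hu c (by simp [hc])).del i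

theorem disjoint_of_lower_of_upper {u w : List ShuffleLetter} (hu : ∀ c ∈ u, ∃ i, c = lower i)
    (hw : ∀ c ∈ w, ∃ j, c = upper j) : u.Disjoint w := by
  intro c hc hc'
  obtain ⟨i, rfl⟩ := hu c hc
  obtain ⟨j, hj⟩ := hw _ hc'
  cases hj

theorem lower_of_mem_lowerWord (m : ℕ) : ∀ c ∈ (lowerWord m).letters, ∃ i, c = lower i := by
  intro c hc
  simp only [lowerWord, List.mem_map] at hc
  obtain ⟨i, -, rfl⟩ := hc
  exact ⟨i, rfl⟩

theorem upper_of_mem_upperWord (n : ℕ) : ∀ c ∈ (upperWord n).letters, ∃ j, c = upper j := by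
  intro c hc
  simp only [upperWord, List.mem_map] at hc
  obtain ⟨i, -, rfl⟩ := hc
  exact ⟨i, rfl⟩

@[simp] theorem length_lowerWord (m : ℕ) : (lowerWord m).letters.length = m := by
  simp [lowerWord]

@[simp] theorem length_upperWord (n : ℕ) : (upperWord n).letters.length = n := by
  simp [upperWord]

theorem lowerWord_le_upperWord (m n : ℕ) : lowerWord m ≤ upperWord n :=
  le_iff_listLE.2 (listLE_of_lower_of_upper (lower_of_mem_lowerWord m) (upper_of_mem_upperWord n))

theorem disjoint_lowerWord_upperWord (m n : ℕ) :
    (lowerWord m).letters.Disjoint (upperWord n).letters :=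
  disjoint_of_lower_of_upper (lower_of_mem_lowerWord m) (upper_of_mem_upperWord n)

theorem eq_iff_of_disjoint {u w : ShuffleWord} (hd : u.letters.Disjoint w.letters) :
    u = w ↔ u.letters.length = 0 ∧ w.letters.length = 0 := by
  constructor
  · rintro rfl
    have : u.letters = [] := List.eq_nil_iff_forall_not_mem.2 fun c hc => hd hc hc
    simp [this]
  · rintro ⟨h₁, h₂⟩
    exact ShuffleWord.ext
      ((List.length_eq_zero_iff.1 h₁).trans (List.length_eq_zero_iff.1 h₂).symm)

theorem isMultiplicative_one : IsMultiplicative (1 : IncidenceAlgebra R ShuffleWord) := by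
  have key : ∀ u w : ShuffleWord, u.letters.Disjoint w.letters →
      (1 : IncidenceAlgebra R ShuffleWord) u w =
        if u.letters.length = 0 ∧ w.letters.length = 0 then 1 else 0 := by
    intro u w hd
    simp only [IncidenceAlgebra.one_apply, eq_iff_of_disjoint hd]
  have hentry : ∀ m n, entry (1 : IncidenceAlgebra R ShuffleWord) m n =
      if m = 0 ∧ n = 0 then 1 else 0 := by
    intro m n
    rw [entry, key _ _ (disjoint_lowerWord_upperWord m n)]
    simp
  refine isMultiplicative_of_split (by simp [hentry]) ?_ ?_
  · intro u w _ hd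
    rw [key u w hd, hentry]
  · intro c u w u₁ u₂ w₁ w₂ _ hu hw
    have : u = w ↔ u₁ = w₁ ∧ u₂ = w₂ := by
      constructor
      · rintro rfl
        obtain ⟨h₁, h₂⟩ := append_cons_inj (hu.symm.trans hw) (hu ▸ u.nodup)
        exact ⟨ShuffleWord.ext h₁, ShuffleWord.ext h₂⟩
      · rintro ⟨rfl, rfl⟩
        exact ShuffleWord.ext (hu.trans hw.symm)
    simp only [IncidenceAlgebra.one_apply, this]
    split_ifs <;> simp_all

theorem bijOn_genSeries : Set.BijOn (genSeries (R := R)) {f | IsMultiplicative f}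
    {F | MvPowerSeries.constantCoeff F = 1} := by
  refine ⟨fun f hf => ?_, fun f hf g hg hfg => ?_, fun F hF => ?_⟩
  · exact hf.1
  · have he : entry f = entry g := by
      funext m n
      let d : Fin 2 →₀ ℕ := Finsupp.single 0 m + Finsupp.single 1 n
      have h0 : d 0 = m := by simp [d]
      have h1 : d 1 = n := by simp [d]
      have h : entry f (d 0) (d 1) = entry g (d 0) (d 1) := congrFun hfg d
      rwa [h0, h1] at h
    ext u w
    by_cases h : u ≤ w
    · rw [IsMultiplicative.apply_eq_weight hf h, IsMultiplicative.apply_eq_weight hg h, he]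
    · rw [IncidenceAlgebra.apply_eq_zero_of_not_le h, IncidenceAlgebra.apply_eq_zero_of_not_le h]
  · let φ : ℕ → ℕ → R := fun m n => F (Finsupp.single 0 m + Finsupp.single 1 n)
    classical
    -- The preimage of `F` is forced: products of its coefficients over canonical types.
    let f : IncidenceAlgebra R ShuffleWord :=
      ⟨fun u w => if u ≤ w then weight φ u.letters w.letters else 0, fun u w h => if_neg h⟩
    have hf : ∀ u w, u ≤ w → f u w = weight φ u.letters w.letters := fun u w h => if_pos h
    have he : entry f = φ := by
      funext m n
      rw [entry, hf _ _ (lowerWord_le_upperWord m n),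
        weight_of_disjoint _ (disjoint_lowerWord_upperWord m n)]
      simp
    refine ⟨f, ⟨?_, fun u w h => ?_⟩, ?_⟩
    · rw [he]
      simp only [φ, Finsupp.single_zero, add_zero]
      exact hF
    · rw [he]; exact hf u w h
    · funext d
      simp only [genSeries, he, φ]
      congr 1
      ext i
      fin_cases i <;> simp

end ShuffleWord

/-! ### Convolution on intervals without common letters -/

namespace ShuffleWord

open ShuffleLetter

variable {R : Type*} [CommRing R]

/-- The lists obtained by shuffling a sublist of `u` with a sublist of `w`, enumerated by the
first letter. -/
def shuffles {α : Type*} (u w : List α) : List (List α) :=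
  [] :: ((List.finRange u.length).flatMap fun (i : Fin u.length) =>
      (shuffles (u.drop (i + 1)) w).map (u[i] :: ·)) ++
    (List.finRange w.length).flatMap fun (j : Fin w.length) =>
      (shuffles u (w.drop (j + 1))).map (w[j] :: ·)
termination_by u.length + w.length
decreasing_by all_goals (simp only [List.length_drop]; omega)

/-- A lower letter cannot be inserted, so it must be matched with some `u[i]`, and the letters of
`u` before it are deleted. -/
theorem listLE_lower_cons_iff {u v : List ShuffleLetter} (hu : ∀ c ∈ u, ∃ i, c = lower i) {k : ℕ} :
    ListLE u (lower k :: v) ↔ ∃ i : Fin u.length, u[i] = lower k ∧ ListLE (u.drop (i + 1)) v := by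
  induction u with
  | nil => exact ⟨fun h => (by cases h), fun ⟨i, _⟩ => i.elim0⟩
  | cons c u ih =>
    have ih := ih fun c hc => hu c (by simp [hc])
    constructor
    · intro h
      cases h with
      | cons _ h => exact ⟨⟨0, by simp⟩, rfl, by simpa using h⟩
      | del _ h =>
        obtain ⟨i, hi, h⟩ := ih.1 h
        exact ⟨i.succ, by simpa using hi, by simpa using h⟩
    · rintro ⟨i, hi, h⟩
      induction i using Fin.cases with
      | zero =>
        simp only [Fin.getElem_fin, Fin.val_zero, List.getElem_cons_zero] at hi
        subst hi
        exact ListLE.cons _ (by simpa using h)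
      | succ i =>
        obtain ⟨a, rfl⟩ := hu c (by simp)
        exact (ih.2 ⟨i, by simpa using hi, by simpa using h⟩).del a

theorem listLE_cons_upper_iff {v w : List ShuffleLetter} (hw : ∀ c ∈ w, ∃ j, c = upper j) {k : ℕ} :
    ListLE (upper k :: v) w ↔ ∃ j : Fin w.length, w[j] = upper k ∧ ListLE v (w.drop (j + 1)) := by
  induction w with
  | nil => exact ⟨fun h => (by cases h), fun ⟨i, _⟩ => i.elim0⟩
  | cons c w ih =>
    have ih := ih fun c hc => hw c (by simp [hc])
    constructor
    · intro h
      cases h with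
      | cons _ h => exact ⟨⟨0, by simp⟩, rfl, by simpa using h⟩
      | ins _ h =>
        obtain ⟨i, hi, h⟩ := ih.1 h
        exact ⟨i.succ, by simpa using hi, by simpa using h⟩
    · rintro ⟨i, hi, h⟩
      induction i using Fin.cases with
      | zero =>
        simp only [Fin.getElem_fin, Fin.val_zero, List.getElem_cons_zero] at hi
        subst hi
        exact ListLE.cons _ (by simpa using h)
      | succ i =>
        obtain ⟨a, rfl⟩ := hw c (by simp)
        exact (ih.2 ⟨i, by simpa using hi, by simpa using h⟩).ins a

theorem listLE_cons_lower_iff {v w : List ShuffleLetter} (hw : ∀ c ∈ w, ∃ j, c = upper j) {k : ℕ} :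
    ListLE (lower k :: v) w ↔ ListLE v w := by
  refine ⟨fun h => ?_, fun h => h.del k⟩
  induction w with
  | nil => cases h; assumption
  | cons c w ih =>
    cases h with
    | cons _ h => obtain ⟨j, hj⟩ := hw _ (List.mem_cons_self); cases hj
    | del _ h => exact h
    | ins j h => exact (ih (fun c hc => hw c (by simp [hc])) h).ins j

theorem listLE_upper_cons_iff {u v : List ShuffleLetter} (hu : ∀ c ∈ u, ∃ i, c = lower i) {k : ℕ} :
    ListLE u (upper k :: v) ↔ ListLE u v := by
  refine ⟨fun h => ?_, fun h => h.ins k⟩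
  induction u with
  | nil => cases h; assumption
  | cons c u ih =>
    cases h with
    | cons _ h => obtain ⟨j, hj⟩ := hu _ (List.mem_cons_self); cases hj
    | ins _ h => exact h
    | del j h => exact (ih (fun c hc => hu c (by simp [hc])) h).del j

theorem mem_shuffles {u w : List ShuffleLetter} (hu : ∀ c ∈ u, ∃ i, c = lower i)
    (hw : ∀ c ∈ w, ∃ j, c = upper j) (v : List ShuffleLetter) :
    v ∈ shuffles u w ↔ ListLE u v ∧ ListLE v w := by
  induction v generalizing u w with
  | nil =>
    rw [shuffles]
    simpa using ⟨listLE_of_lower_of_upper hu (w := []) (by simp),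
      listLE_of_lower_of_upper (u := []) (by simp) hw⟩
  | cons c v ih =>
    have hdu : ∀ n, ∀ c ∈ u.drop n, ∃ i, c = lower i := fun n c hc => hu c (List.mem_of_mem_drop hc)
    have hdw : ∀ n, ∀ c ∈ w.drop n, ∃ i, c = upper i := fun n c hc => hw c (List.mem_of_mem_drop hc)
    rw [shuffles]
    simp only [List.cons_append, List.mem_cons, reduceCtorEq, List.mem_append, List.mem_flatMap,
      List.mem_finRange, List.mem_map, List.cons.injEq, true_and, false_or, exists_eq_right,
      ← and_assoc]
    simp only [ih (hdu _) hw, ih hu (hdw _)]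
    rcases c with k | k
    · rw [listLE_lower_cons_iff hu, listLE_cons_lower_iff hw]
      constructor
      · rintro (⟨i, ⟨h₁, h₂⟩, h₃⟩ | ⟨j, -, h⟩)
        · exact ⟨⟨i, h₃, h₁⟩, h₂⟩
        · obtain ⟨j', hj'⟩ := hw w[j] (List.getElem_mem _)
          simp_all
      · rintro ⟨⟨i, h₃, h₁⟩, h₂⟩
        exact Or.inl ⟨i, ⟨h₁, h₂⟩, h₃⟩
    · rw [listLE_upper_cons_iff hu, listLE_cons_upper_iff hw]
      constructor
      · rintro (⟨j, -, h⟩ | ⟨i, ⟨h₁, h₂⟩, h₃⟩)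
        · obtain ⟨j', hj'⟩ := hu u[j] (List.getElem_mem _)
          simp_all
        · exact ⟨h₁, ⟨i, h₃, h₂⟩⟩
      · rintro ⟨h₁, ⟨i, h₃, h₂⟩⟩
        exact Or.inr ⟨i, ⟨h₁, h₂⟩, h₃⟩

/-- Different branches of the enumeration start with different letters. -/
theorem nodup_shuffles {α : Type*} {u w : List α} (hu : u.Nodup) (hw : w.Nodup)
    (hd : u.Disjoint w) : (shuffles u w).Nodup := by
  induction hn : u.length + w.length using Nat.strong_induction_on generalizing u w with
  | _ n ih =>
    rw [shuffles]
    simp only [List.cons_append, List.nodup_cons, List.nodup_append', List.nodup_flatMap]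
    refine ⟨by simp, ⟨?_, ?_⟩, ⟨?_, ?_⟩, ?_⟩
    · intro i _
      refine (ih _ ?_ (hu.sublist (List.drop_sublist _ _)) hw
        (fun a ha => hd (List.mem_of_mem_drop ha)) rfl).map (List.cons_injective)
      simp; omega
    · refine (List.nodup_finRange _).imp ?_
      intro i j hij l hl hl'
      simp only [List.mem_map] at hl hl'
      obtain ⟨a, -, rfl⟩ := hl
      obtain ⟨b, -, hb⟩ := hl'
      have := (List.cons.inj hb).1
      exact hij (Fin.ext ((hu.getElem_inj_iff).1 this).symm)
    · intro i _
      refine (ih _ ?_ hu (hw.sublist (List.drop_sublist _ _))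
        (fun a ha ha' => hd ha (List.mem_of_mem_drop ha')) rfl).map (List.cons_injective)
      simp; omega
    · refine (List.nodup_finRange _).imp ?_
      intro i j hij l hl hl'
      simp only [List.mem_map] at hl hl'
      obtain ⟨a, -, rfl⟩ := hl
      obtain ⟨b, -, hb⟩ := hl'
      have := (List.cons.inj hb).1
      exact hij (Fin.ext ((hw.getElem_inj_iff).1 this).symm)
    · intro l hl hl'
      simp only [List.mem_flatMap, List.mem_map] at hl hl'
      obtain ⟨i, -, a, -, rfl⟩ := hl
      obtain ⟨j, -, b, -, hb⟩ := hl'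
      have := (List.cons.inj hb).1
      exact hd (List.getElem_mem i.2) (this ▸ List.getElem_mem j.2)

/-- The convolution of `φ` and `ψ` over the words between `a₁ ⋯ aₘ` and `x₁ ⋯ xₙ`, where `a`
lower and `b` upper letters have been read since the last upper and the last lower letter. -/
def convCoeff (φ ψ : ℕ → ℕ → R) (a b m n : ℕ) : R :=
  φ m b * ψ a n + ∑ i : Fin m, φ i b * convCoeff φ ψ (a + 1) 0 (m - 1 - i) n +
    ∑ j : Fin n, ψ a j * convCoeff φ ψ 0 (b + 1) m (n - 1 - j)
termination_by m + n
decreasing_by all_goals omega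

theorem sum_shuffles {α : Type*} (u w : List α) (k : List α → R) :
    ((shuffles u w).map k).sum = k [] +
      ∑ i : Fin u.length, ((shuffles (u.drop (i + 1)) w).map fun v => k (u[i] :: v)).sum +
      ∑ j : Fin w.length, ((shuffles u (w.drop (j + 1))).map fun v => k (w[j] :: v)).sum := by
  have aux : ∀ {n : ℕ} (F : Fin n → List (List α)),
      (((List.finRange n).flatMap F).map k).sum = ∑ i, ((F i).map k).sum := by
    intro n F
    rw [List.map_flatMap, List.flatMap_def, List.sum_flatten, List.map_map, ← List.ofFn_eq_map, List.sum_ofFn]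
    rfl
  rw [shuffles]
  simp only [List.cons_append, List.map_cons, List.map_append, List.sum_cons, List.sum_append, aux,
    List.map_map, Function.comp_def, add_assoc]

/-- By `hp` and `hmem`, `u[i]` is the first common letter, so it closes a factor with `i` letters of
`u` against those of `p`. -/
theorem listType_getElem_cons {p u v : List ShuffleLetter} (nu : u.Nodup) (hp : u.Disjoint p)
    (i : Fin u.length) (hmem : ∀ x ∈ u, x ∈ v → x ∈ u.drop (i + 1)) :
    listType u (p ++ u[i] :: v) = ((i : ℕ), p.length) :: listType (u.drop (i + 1)) v := by
  have hsplit : u.take i ++ u[i] :: u.drop (i + 1) = u := by simp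
  have hd : (u.take i).Disjoint p := fun c hc => hp (List.mem_of_mem_take hc)
  have nu' := nu
  rw [← hsplit] at nu'
  simp only [List.nodup_append', List.nodup_cons, List.disjoint_cons_right] at nu'
  obtain ⟨n₁, ⟨c₂, n₂⟩, c₁, d⟩ := nu'
  have key : listType (u.take i ++ u[i] :: u.drop (i + 1)) (p ++ u[i] :: v) =
      listType (u.take i) p ++ listType (u.drop (i + 1)) v := by
    apply listType_append_cons_of_length
    · intro x hx
      rw [List.mem_append, List.mem_cons, or_iff_left]
      rintro (rfl | hv)
      · exact c₁ hx
      · exact d hx (hmem x (List.mem_of_mem_take hx) hv)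
    · intro x hx
      rw [List.mem_append, List.mem_cons, or_iff_right (hp (List.mem_of_mem_drop hx)),
        or_iff_right]
      rintro rfl
      exact c₂ hx
    · intro x hx
      rw [hsplit]
      exact ⟨fun h => absurd hx (hp h), fun h => List.mem_of_mem_take h⟩
    · intro x hx
      rw [hsplit]
      exact ⟨fun h => hmem x h hx, fun h => List.mem_of_mem_drop h⟩
    · rw [List.countP_eq_zero.2, List.countP_eq_zero.2]
      · intro x hx; simpa using fun h => hd h hx
      · intro x hx; simpa using fun h => hd hx h
  rw [hsplit] at key
  rw [key, listType_of_disjoint hd]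
  simp [i.2.le]

theorem listType_swap (u w : List ShuffleLetter) :
    listType w u = (listType u w).map Prod.swap := by
  rw [listType, listType, List.zip_swap]

theorem listType_cons_getElem {p w v : List ShuffleLetter} (nw : w.Nodup) (hp : w.Disjoint p)
    (j : Fin w.length) (hmem : ∀ x ∈ w, x ∈ v → x ∈ w.drop (j + 1)) :
    listType (p ++ w[j] :: v) w = (p.length, (j : ℕ)) :: listType v (w.drop (j + 1)) := by
  rw [listType_swap, listType_getElem_cons nw hp j hmem, List.map_cons, ← listType_swap]
  rfl

/-- Here `p` and `q` are the letters of the middle word already read but not yet enclosed in a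
closed factor of the type of `[v, w]` and of `[u, v]`. Reading `u[i]` lengthens `p` and empties `q`;
reading `w[j]` does the opposite. -/
theorem sum_weight_shuffles (φ ψ : ℕ → ℕ → R) {u w p q : List ShuffleLetter}
    (hu : ∀ c ∈ u, ∃ i, c = lower i) (hw : ∀ c ∈ w, ∃ j, c = upper j)
    (hp : ∀ c ∈ p, ∃ i, c = lower i) (hq : ∀ c ∈ q, ∃ j, c = upper j)
    (nu : u.Nodup) (nw : w.Nodup) :
    ((shuffles u w).map fun v => weight φ u (q ++ v) * weight ψ (p ++ v) w).sum =
      convCoeff φ ψ p.length q.length u.length w.length := by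
  induction hn : u.length + w.length using Nat.strong_induction_on generalizing u w p q with
  | _ n ih =>
    have hdu : ∀ n, ∀ c ∈ u.drop n, ∃ i, c = lower i := fun n c hc => hu c (List.mem_of_mem_drop hc)
    have hdw : ∀ n, ∀ c ∈ w.drop n, ∃ i, c = upper i := fun n c hc => hw c (List.mem_of_mem_drop hc)
    have huq := disjoint_of_lower_of_upper hu hq
    have hpw := disjoint_of_lower_of_upper hp hw
    rw [sum_shuffles, convCoeff]
    congr 1
    · congr 1
      · simp [weight_of_disjoint φ huq, weight_of_disjoint ψ hpw]
      · refine Finset.sum_congr rfl fun i _ => ?_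
        have hp' : ∀ c ∈ p ++ [u[i]], ∃ i, c = lower i := by
          intro c hc
          rcases List.mem_append.1 hc with hc | hc
          · exact hp c hc
          · rw [List.mem_singleton.1 hc]; exact hu _ (List.getElem_mem _)
        have := ih _ (by simp only [List.length_drop]; omega) (hdu (i + 1)) hw hp' (q := [])
          (by simp) (nu.sublist (List.drop_sublist _ _)) nw rfl
        simp only [List.length_append, List.length_singleton, List.length_nil, List.length_drop,
          List.nil_append] at this
        rw [show u.length - 1 - i = u.length - (i + 1) by omega, ← this, ← List.sum_map_mul_left]
        congr 1
        refine List.map_congr_left fun v hv => ?_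
        rw [mem_shuffles (hdu _) hw] at hv
        have hmem : ∀ x ∈ u, x ∈ v → x ∈ u.drop (i + 1) := by
          intro x hx hxv
          obtain ⟨k, rfl⟩ := hu x hx
          exact hv.1.lower_mem hxv
        rw [weight, listType_getElem_cons nu huq i hmem, List.append_cons p]
        simp [weight, mul_assoc]
    · refine Finset.sum_congr rfl fun j _ => ?_
      have hq' : ∀ c ∈ q ++ [w[j]], ∃ j, c = upper j := by
        intro c hc
        rcases List.mem_append.1 hc with hc | hc
        · exact hq c hc
        · rw [List.mem_singleton.1 hc]; exact hw _ (List.getElem_mem _)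
      have := ih _ (by simp only [List.length_drop]; omega) hu (hdw (j + 1)) (p := []) (by simp) hq'
        nu (nw.sublist (List.drop_sublist _ _)) rfl
      simp only [List.length_append, List.length_singleton, List.length_nil, List.length_drop,
        List.nil_append] at this
      rw [show w.length - 1 - j = w.length - (j + 1) by omega, ← this, ← List.sum_map_mul_left]
      congr 1
      refine List.map_congr_left fun v hv => ?_
      rw [mem_shuffles hu (hdw _)] at hv
      have hmem : ∀ x ∈ w, x ∈ v → x ∈ w.drop (j + 1) := by
        intro x hx hxv
        obtain ⟨k, rfl⟩ := hw x hx
        exact hv.2.upper_mem hxv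
      rw [weight, weight, listType_cons_getElem nw hpw.symm j hmem, List.append_cons q]
      simp only [weight, List.map_cons, List.prod_cons]
      ring

theorem IsMultiplicative.mul_apply_of_disjoint {f g : IncidenceAlgebra R ShuffleWord}
    (hf : IsMultiplicative f) (hg : IsMultiplicative g) {u w : ShuffleWord} (h : u ≤ w)
    (hd : u.letters.Disjoint w.letters) :
    (f * g) u w = convCoeff (entry f) (entry g) 0 0 u.letters.length w.letters.length := by
  obtain ⟨hu, hw⟩ := eq_lower_of_disjoint (le_iff_listLE.1 h) hd
  have hsum := sum_weight_shuffles (entry f) (entry g) hu hw (p := []) (q := []) (by simp)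
    (by simp) u.nodup w.nodup
  rw [List.length_nil] at hsum
  rw [← hsum, IncidenceAlgebra.mul_apply,
    ← List.sum_toFinset _ (nodup_shuffles u.nodup w.nodup hd)]
  have key : ∀ {v}, v ∈ (shuffles u.letters w.letters).toFinset ↔
      ListLE u.letters v ∧ ListLE v w.letters := by
    intro v
    rw [List.mem_toFinset, mem_shuffles hu hw]
  refine Finset.sum_bij (fun v _ => v.letters) ?_ ?_ ?_ ?_
  · intro v hv
    rw [Finset.mem_Icc, le_iff_listLE, le_iff_listLE] at hv
    exact key.2 hv
  · intro v _ v' _ h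
    exact ShuffleWord.ext h
  · intro v hv
    obtain ⟨h₁, h₂⟩ := key.1 hv
    exact ⟨ofBetween u w v h₁ h₂, by
      rw [Finset.mem_Icc, le_iff_listLE, le_iff_listLE]; exact ⟨h₁, h₂⟩, rfl⟩
  · intro v hv
    rw [Finset.mem_Icc] at hv
    rw [hf.apply_eq_weight hv.1, hg.apply_eq_weight hv.2]
    rfl

theorem IsMultiplicative.entry_mul {f g : IncidenceAlgebra R ShuffleWord}
    (hf : IsMultiplicative f) (hg : IsMultiplicative g) (m n : ℕ) :
    entry (f * g) m n = convCoeff (entry f) (entry g) 0 0 m n := by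
  rw [entry, hf.mul_apply_of_disjoint hg (lowerWord_le_upperWord m n)
    (disjoint_lowerWord_upperWord m n), length_lowerWord, length_upperWord]

theorem IsMultiplicative.mul {f g : IncidenceAlgebra R ShuffleWord}
    (hf : IsMultiplicative f) (hg : IsMultiplicative g) : IsMultiplicative (f * g) := by
  refine isMultiplicative_of_split ?_ (fun u w h hd => ?_)
    fun c u w u₁ u₂ w₁ w₂ _ hu hw => hf.mul_apply_split hg hu hw
  · rw [hf.entry_mul hg, convCoeff, hf.1, hg.1]
    simp
  · rw [hf.mul_apply_of_disjoint hg h hd, hf.entry_mul hg]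

end ShuffleWord

/-! ### Generating series and the convolution formula -/

namespace ShuffleWord

open MvPowerSeries

variable {R : Type*} [CommRing R]

/-- The power series `∑ s_j X_k ^ j` in the variable `X k`. -/
noncomputable def axisSeries {σ : Type*} (k : σ) (s : ℕ → R) : MvPowerSeries σ R :=
  fun d => open scoped Classical in if d = Finsupp.single k (d k) then s (d k) else 0

/-- The power series `∑ s_{ij} x^i y^j`. -/
def seriesMk (s : ℕ → ℕ → R) : MvPowerSeries (Fin 2) R :=
  fun d => s (d 0) (d 1)

theorem coeff_axisSeries {σ : Type*} [DecidableEq σ] (k : σ) (s : ℕ → R) (d : σ →₀ ℕ) :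
    coeff d (axisSeries k s) = if d = Finsupp.single k (d k) then s (d k) else 0 := by
  change axisSeries k s d = _
  rw [axisSeries]
  congr

theorem coeff_seriesMk (s : ℕ → ℕ → R) (d : Fin 2 →₀ ℕ) :
    coeff d (seriesMk s) = s (d 0) (d 1) := rfl

theorem coeff_axisSeries_mul {σ : Type*} [DecidableEq σ] (k : σ) (s : ℕ → R)
    (φ : MvPowerSeries σ R) (d : σ →₀ ℕ) :
    coeff d (axisSeries k s * φ) =
      ∑ j ∈ Finset.range (d k + 1), s j * coeff (d - Finsupp.single k j) φ := by
  rw [coeff_mul]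
  symm
  refine Finset.sum_of_injOn (fun j => (Finsupp.single k j, d - Finsupp.single k j)) ?_ ?_ ?_ ?_
  · intro i _ j _ h
    exact Finsupp.single_injective k (congrArg Prod.fst h)
  · intro j hj
    simp only [Finset.coe_range, Set.mem_Iio] at hj
    simp only [Finset.mem_coe, Finset.HasAntidiagonal.mem_antidiagonal]
    exact add_tsub_cancel_of_le (Finsupp.single_le_iff.2 (Nat.lt_succ_iff.1 hj))
  · rintro ⟨p, q⟩ hpq hn
    rw [Finset.HasAntidiagonal.mem_antidiagonal] at hpq
    dsimp only at hpq ⊢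
    rw [coeff_axisSeries, if_neg, zero_mul]
    intro hp
    apply hn
    refine ⟨p k, ?_, ?_⟩
    · simp only [Finset.coe_range, Set.mem_Iio, ← hpq, Finsupp.add_apply]
      omega
    · dsimp only
      rw [← hp, ← hpq, add_tsub_cancel_left]
  · intro j _
    simp [coeff_axisSeries]

theorem coeff_X_mul_eq {σ : Type*} [DecidableEq σ] (k : σ) (φ : MvPowerSeries σ R) (d : σ →₀ ℕ) :
    coeff d (X k * φ) = if d k = 0 then 0 else coeff (d - Finsupp.single k 1) φ := by
  rw [X, coeff_monomial_mul]
  simp only [Finsupp.single_le_iff, one_mul]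
  split_ifs <;> first | rfl | omega

/-- The sum has the shape of those in `convCoeff`: `j` letters are skipped and one is read, which
accounts for the shift by `j + 1`. -/
theorem coeff_X_mul_axisSeries_mul {σ : Type*} [DecidableEq σ] (k : σ) (s : ℕ → R)
    (φ : MvPowerSeries σ R) (d : σ →₀ ℕ) :
    coeff d (X k * (axisSeries k s * φ)) =
      ∑ j : Fin (d k), s j * coeff (d - Finsupp.single k ((j : ℕ) + 1)) φ := by
  rw [coeff_X_mul_eq, Finset.sum_fin_eq_sum_range (n := d k)]
  split_ifs with h
  · simp [h]
  · rw [coeff_axisSeries_mul]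
    have : (d - Finsupp.single k 1 : σ →₀ ℕ) k + 1 = d k := by simp; omega
    rw [this]
    refine Finset.sum_congr rfl fun j hj => ?_
    rw [dif_pos (Finset.mem_range.1 hj), tsub_tsub, ← Finsupp.single_add, add_comm 1 j]

/-- Every monomial involving a variable other than `X k` is sent to zero. -/
theorem subst_axis {σ : Type*} [DecidableEq σ] {k : σ} {a : σ → MvPowerSeries σ R}
    (ha : HasSubst a) (hk : a k = X k) (h0 : ∀ i, i ≠ k → a i = 0) (φ : MvPowerSeries σ R) :
    subst a φ = axisSeries k fun n => coeff (Finsupp.single k n) φ := by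
  ext e
  have key : ∀ d : σ →₀ ℕ, coeff e (d.prod fun s n => a s ^ n) =
      if d = Finsupp.single k (d k) ∧ e = d then 1 else 0 := by
    intro d
    by_cases hd : d = Finsupp.single k (d k)
    · have : (d.prod fun s n => a s ^ n) = X k ^ d k := by
        conv_lhs => rw [hd]
        rw [Finsupp.prod_single_index (by simp), hk]
      rw [this, coeff_X_pow, ← hd]
      simp only [true_and]
    · rw [if_neg (fun h => hd h.1)]
      obtain ⟨i, hik, hi⟩ : ∃ i, i ≠ k ∧ d i ≠ 0 := by
        by_contra! hcon
        refine hd (Finsupp.ext fun i => ?_)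
        by_cases hik : i = k
        · simp [hik]
        · simp [hcon i hik, Ne.symm hik]
      rw [Finsupp.prod, Finset.prod_eq_zero (Finsupp.mem_support_iff.2 hi), coeff_zero]
      rw [h0 i hik, zero_pow hi]
  rw [coeff_subst ha, finsum_eq_single _ e, key, coeff_axisSeries]
  · simp only [and_true]
    split_ifs with h
    · rw [← h, smul_eq_mul, mul_one]
    · simp
  · intro d hd
    rw [key, if_neg (fun h => hd h.2.symm), smul_zero]

theorem seriesMk_eq_x (s : ℕ → ℕ → R) :
    seriesMk s = axisSeries 1 (s 0) + X 0 * seriesMk fun m n => s (m + 1) n := by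
  ext d
  rw [map_add, coeff_axisSeries, coeff_X_mul_eq, coeff_seriesMk, coeff_seriesMk]
  have hd : d = Finsupp.single 1 (d 1) ↔ d 0 = 0 := by
    rw [Finsupp.ext_iff, Fin.forall_fin_two]; simp
  simp only [hd]
  split_ifs with h
  · simp [h]
  · simp [Nat.sub_add_cancel (Nat.pos_of_ne_zero h)]

theorem seriesMk_eq_y (s : ℕ → ℕ → R) :
    seriesMk s = axisSeries 0 (fun m => s m 0) + X 1 * seriesMk fun m n => s m (n + 1) := by
  ext d
  rw [map_add, coeff_axisSeries, coeff_X_mul_eq, coeff_seriesMk, coeff_seriesMk]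
  have hd : d = Finsupp.single 0 (d 0) ↔ d 1 = 0 := by
    rw [Finsupp.ext_iff, Fin.forall_fin_two]; simp
  simp only [hd]
  split_ifs with h
  · simp [h]
  · simp [Nat.sub_add_cancel (Nat.pos_of_ne_zero h)]

theorem subst_X_zero_seriesMk (s : ℕ → ℕ → R) :
    (seriesMk s).subst ![X 0, (0 : MvPowerSeries (Fin 2) R)] = axisSeries 0 fun m => s m 0 := by
  rw [subst_axis (k := 0) HasSubst.X_zero (by simp) (by simp [Fin.forall_fin_two])]
  simp [coeff_seriesMk]

theorem subst_zero_X_seriesMk (s : ℕ → ℕ → R) :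
    (seriesMk s).subst ![(0 : MvPowerSeries (Fin 2) R), X 1] = axisSeries 1 (s 0) := by
  rw [subst_axis (k := 1) HasSubst.zero_X (by simp) (by simp [Fin.forall_fin_two])]
  simp [coeff_seriesMk]

theorem hasSubst_mul_X_left (A : MvPowerSeries (Fin 2) R) : HasSubst ![A * X 0, X 1] :=
  hasSubst_of_constantCoeff_zero (by simp [Fin.forall_fin_two])

theorem hasSubst_mul_X_right (A : MvPowerSeries (Fin 2) R) : HasSubst ![X 0, A * X 1] :=
  hasSubst_of_constantCoeff_zero (by simp [Fin.forall_fin_two])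

/-- A series in `y` alone is itself a substitution with `x = 0`, so composing substitutions shows
that rescaling `x` leaves it unchanged. -/
theorem subst_axisSeries_one (A : MvPowerSeries (Fin 2) R) (s : ℕ → R) :
    (axisSeries 1 s).subst ![A * X 0, X 1] = axisSeries (1 : Fin 2) s := by
  rw [← subst_zero_X_seriesMk (fun _ => s),
    subst_comp_subst_apply HasSubst.zero_X (hasSubst_mul_X_left A)]
  congr 1
  funext i
  fin_cases i
  · exact (congrFun (coe_substAlgHom (hasSubst_mul_X_left A)) 0).symm.trans (map_zero _)
  · exact subst_X (hasSubst_mul_X_left A) 1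

theorem subst_axisSeries_zero (A : MvPowerSeries (Fin 2) R) (s : ℕ → R) :
    (axisSeries 0 s).subst ![X 0, A * X 1] = axisSeries (0 : Fin 2) s := by
  rw [← subst_X_zero_seriesMk (fun m _ => s m),
    subst_comp_subst_apply HasSubst.X_zero (hasSubst_mul_X_right A)]
  congr 1
  funext i
  fin_cases i
  · exact subst_X (hasSubst_mul_X_right A) 0
  · exact (congrFun (coe_substAlgHom (hasSubst_mul_X_right A)) 0).symm.trans (map_zero _)

theorem subst_seriesMk_x (A : MvPowerSeries (Fin 2) R) (s : ℕ → ℕ → R) :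
    (seriesMk s).subst ![A * X 0, X 1] = axisSeries 1 (s 0) +
      A * X 0 * (seriesMk fun m n => s (m + 1) n).subst ![A * X 0, X 1] := by
  have h := hasSubst_mul_X_left A
  conv_lhs => rw [seriesMk_eq_x, subst_add h, subst_mul h, subst_X h, subst_axisSeries_one]
  simp

theorem subst_seriesMk_y (A : MvPowerSeries (Fin 2) R) (s : ℕ → ℕ → R) :
    (seriesMk s).subst ![X 0, A * X 1] = axisSeries 0 (fun m => s m 0) +
      A * X 1 * (seriesMk fun m n => s m (n + 1)).subst ![X 0, A * X 1] := by
  have h := hasSubst_mul_X_right A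
  conv_lhs => rw [seriesMk_eq_y, subst_add h, subst_mul h, subst_X h, subst_axisSeries_zero]
  simp

theorem eq_zero_of_X_pow_dvd {σ : Type*} (k : σ) {φ : MvPowerSeries σ R}
    (h : ∀ n, X k ^ n ∣ φ) : φ = 0 := by
  ext d
  exact X_pow_dvd_iff.1 (h (d k + 1)) d (Nat.lt_succ_self _)

/-- Both `P n` and `H n * D` solve the same recursion. Each unfolding pulls a factor `A * X k` out
of their difference, which is thus divisible by every power of `X k`; no infinite sum is needed. -/
theorem eq_mul_of_recursion {σ : Type*} (k : σ) {A D : MvPowerSeries σ R}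
    {G H P : ℕ → MvPowerSeries σ R} (hH : ∀ n, H n = G n + A * X k * H (n + 1))
    (hP : ∀ n, P n = G n * D + A * X k * P (n + 1)) : P 0 = H 0 * D := by
  rw [← sub_eq_zero]
  have key : ∀ n, P 0 - H 0 * D = X k ^ n * (A ^ n * (P n - H n * D)) := by
    intro n
    induction n with
    | zero => simp
    | succ n ih =>
      rw [ih, hH n, hP n]
      ring
  exact eq_zero_of_X_pow_dvd k fun n => ⟨_, key n⟩

theorem seriesMk_convCoeff (φ ψ : ℕ → ℕ → R) (a b : ℕ) :
    seriesMk (convCoeff φ ψ a b) = axisSeries 0 (fun m => φ m b) * axisSeries 1 (ψ a) +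
      X 0 * (axisSeries 0 (fun m => φ m b) * seriesMk (convCoeff φ ψ (a + 1) 0)) +
      X 1 * (axisSeries 1 (ψ a) * seriesMk (convCoeff φ ψ 0 (b + 1))) := by
  ext d
  rw [map_add, map_add, coeff_X_mul_axisSeries_mul, coeff_X_mul_axisSeries_mul, coeff_seriesMk,
    convCoeff]
  congr 1
  · congr 1
    · rw [coeff_axisSeries_mul, Finset.sum_eq_single (d 0)]
      · have : d - Finsupp.single 0 (d 0) = Finsupp.single 1 (d 1) := by
          rw [Finsupp.ext_iff, Fin.forall_fin_two]; simp
        rw [this, coeff_axisSeries]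
        simp
      · intro j hj hne
        rw [Finset.mem_range] at hj
        rw [coeff_axisSeries, if_neg, mul_zero]
        intro h
        have := DFunLike.congr_fun h 0
        simp at this
        omega
      · simp
    · refine Finset.sum_congr rfl fun j _ => ?_
      simp [coeff_seriesMk, Nat.sub_sub, add_comm]
  · refine Finset.sum_congr rfl fun j _ => ?_
    simp [coeff_seriesMk, Nat.sub_sub, add_comm]

/-- Divide `h` by `p * f * g`, using that `d / p = 1 / s` and `e / p = 1 / t`. -/
theorem inverse_eq_of_factorizations {S : Type*} [CommRing S] {p s t d e f g : S}
    (hp : IsUnit p) (hs : IsUnit s) (ht : IsUnit t) (hf : IsUnit f) (hg : IsUnit g)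
    (h₁ : p = s * d) (h₂ : p = t * e) (h : p = f * e + g * d - f * g) :
    Ring.inverse p = Ring.inverse (t * g) + Ring.inverse (f * s) - Ring.inverse (f * g) := by
  obtain ⟨p, rfl⟩ := hp
  obtain ⟨s, rfl⟩ := hs
  obtain ⟨t, rfl⟩ := ht
  obtain ⟨f, rfl⟩ := hf
  obtain ⟨g, rfl⟩ := hg
  have hd : d = ↑s⁻¹ * ↑p := by rw [h₁, Units.inv_mul_cancel_left]
  have he : e = ↑t⁻¹ * ↑p := by rw [h₂, Units.inv_mul_cancel_left]
  rw [hd, he] at h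
  simp only [← Units.val_mul, Ring.inverse_unit, mul_inv]
  simp only [Units.val_mul]
  have hpp : (p : S) * ↑p⁻¹ = 1 := p.mul_inv
  have hff : (f : S) * ↑f⁻¹ = 1 := f.mul_inv
  have hgg : (g : S) * ↑g⁻¹ = 1 := g.mul_inv
  have h' : (1 : S) = f * ↑t⁻¹ + g * ↑s⁻¹ - f * g * ↑p⁻¹ := by
    linear_combination (↑p⁻¹ : S) * h - (1 - f * ↑t⁻¹ - g * ↑s⁻¹) * hpp
  linear_combination (↑f⁻¹ * ↑g⁻¹ : S) * h' + (↑t⁻¹ * ↑g⁻¹ - g * ↑g⁻¹ * ↑p⁻¹ : S) * hff +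
    (↑f⁻¹ * ↑s⁻¹ - ↑p⁻¹ : S) * hgg

theorem constantCoeff_axisSeries {σ : Type*} (k : σ) (s : ℕ → R) :
    constantCoeff (axisSeries k s) = s 0 := by
  classical
  rw [← coeff_zero_eq_constantCoeff_apply, coeff_axisSeries]
  simp

theorem isUnit_of_constantCoeff_eq_one {σ : Type*} {φ : MvPowerSeries σ R}
    (h : constantCoeff φ = 1) : IsUnit φ := by
  rw [isUnit_iff_constantCoeff, h]
  exact isUnit_one

theorem inverse_seriesMk_convCoeff {φ ψ : ℕ → ℕ → R} (hφ : φ 0 0 = 1) (hψ : ψ 0 0 = 1)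
    {F₀ G₀ Ft Gt : MvPowerSeries (Fin 2) R}
    (hF₀ : F₀ = (seriesMk φ).subst ![X 0, (0 : MvPowerSeries (Fin 2) R)])
    (hG₀ : G₀ = (seriesMk ψ).subst ![(0 : MvPowerSeries (Fin 2) R), X 1])
    (hFt : Ft = (seriesMk φ).subst ![X 0, G₀ * X 1])
    (hGt : Gt = (seriesMk ψ).subst ![F₀ * X 0, X 1]) :
    IsUnit (seriesMk (convCoeff φ ψ 0 0)) ∧ IsUnit Ft ∧ IsUnit Gt ∧ IsUnit F₀ ∧ IsUnit G₀ ∧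
      Ring.inverse (seriesMk (convCoeff φ ψ 0 0)) =
        Ring.inverse (Ft * G₀) + Ring.inverse (F₀ * Gt) - Ring.inverse (F₀ * G₀) := by
  rw [subst_X_zero_seriesMk] at hF₀
  rw [subst_zero_X_seriesMk] at hG₀
  have uF₀ : IsUnit F₀ := isUnit_of_constantCoeff_eq_one (by
    rw [hF₀, constantCoeff_axisSeries, hφ])
  have uG₀ : IsUnit G₀ := isUnit_of_constantCoeff_eq_one (by
    rw [hG₀, constantCoeff_axisSeries, hψ])
  have uFt : IsUnit Ft := isUnit_of_constantCoeff_eq_one (by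
    rw [hFt, subst_seriesMk_y]
    simp [constantCoeff_axisSeries, hφ])
  have uGt : IsUnit Gt := isUnit_of_constantCoeff_eq_one (by
    rw [hGt, subst_seriesMk_x]
    simp [constantCoeff_axisSeries, hψ])
  have uP : IsUnit (seriesMk (convCoeff φ ψ 0 0)) := isUnit_of_constantCoeff_eq_one (by
    rw [seriesMk_convCoeff]
    simp [constantCoeff_axisSeries, hφ, hψ])
  refine ⟨uP, uFt, uGt, uF₀, uG₀, ?_⟩
  let P : ℕ → ℕ → MvPowerSeries (Fin 2) R := fun a b => seriesMk (convCoeff φ ψ a b)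
  have hP : ∀ a b, P a b = axisSeries 0 (fun m => φ m b) * axisSeries 1 (ψ a) +
      X 0 * (axisSeries 0 (fun m => φ m b) * P (a + 1) 0) +
      X 1 * (axisSeries 1 (ψ a) * P 0 (b + 1)) := seriesMk_convCoeff φ ψ
  -- Reading an upper letter resets `a` to zero, so `P 0 1` appears in the recursion for `P k 0`
  -- whatever `k` is. This makes the cofactor `F₀ + X 1 * P 0 1` constant along the iteration.
  have hx : P 0 0 = Gt * (F₀ + X 1 * P 0 1) := by
    rw [hGt]
    -- `H k` is the series `∑ ψ (m + k) n (F₀ x)^m y^n`, whose value at `k = 0` is `Gt`.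
    refine eq_mul_of_recursion 0 (A := F₀) (G := fun k => axisSeries 1 (ψ k))
      (H := fun k => (seriesMk fun m n => ψ (m + k) n).subst ![F₀ * X 0, X 1])
      (P := fun k => P k 0) (fun k => ?_) (fun k => ?_)
    · rw [subst_seriesMk_x, zero_add]
      simp only [add_right_comm _ 1 k, add_assoc]
    · rw [hP k 0, ← hF₀]
      ring
  have hy : P 0 0 = Ft * (G₀ + X 0 * P 1 0) := by
    rw [hFt]
    refine eq_mul_of_recursion 1 (A := G₀) (G := fun k => axisSeries 0 fun m => φ m k)
      (H := fun k => (seriesMk fun m n => φ m (n + k)).subst ![X 0, G₀ * X 1])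
      (P := fun k => P 0 k) (fun k => ?_) (fun k => ?_)
    · rw [subst_seriesMk_y, zero_add]
      simp only [add_right_comm _ 1 k, add_assoc]
    · rw [hP 0 k, ← hG₀]
      ring
  refine inverse_eq_of_factorizations uP uGt uFt uF₀ uG₀ hx hy ?_
  change P 0 0 = _
  rw [hP 0 0, ← hF₀, ← hG₀]
  ring

end ShuffleWord

theorem theorem5p2 {R : Type*} [CommRing R] :
    -- the multiplicative functions form a submonoid of the incidence algebra
    ShuffleWord.IsMultiplicative (1 : IncidenceAlgebra R ShuffleWord) ∧
    (∀ f g : IncidenceAlgebra R ShuffleWord,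
      ShuffleWord.IsMultiplicative f → ShuffleWord.IsMultiplicative g → ShuffleWord.IsMultiplicative (f * g)) ∧
    -- they correspond to the series with constant term 1
    Set.BijOn (ShuffleWord.genSeries (R := R)) {f | ShuffleWord.IsMultiplicative f}
      {F | MvPowerSeries.constantCoeff F = 1} ∧
    -- convolution in terms of series
    ∀ f g : IncidenceAlgebra R ShuffleWord, ShuffleWord.IsMultiplicative f → ShuffleWord.IsMultiplicative g →
      ∀ F G F₀ G₀ Ft Gt FG : MvPowerSeries (Fin 2) R,
        F = ShuffleWord.genSeries f → G = ShuffleWord.genSeries g → FG = ShuffleWord.genSeries (f * g) →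
        F₀ = F.subst ![MvPowerSeries.X 0, 0] →
        G₀ = G.subst ![0, MvPowerSeries.X 1] →
        Ft = F.subst ![MvPowerSeries.X 0, G₀ * MvPowerSeries.X 1] →
        Gt = G.subst ![F₀ * MvPowerSeries.X 0, MvPowerSeries.X 1] →
        IsUnit FG ∧ IsUnit Ft ∧ IsUnit Gt ∧ IsUnit F₀ ∧ IsUnit G₀ ∧
        Ring.inverse FG =
          Ring.inverse (Ft * G₀) + Ring.inverse (F₀ * Gt) - Ring.inverse (F₀ * G₀) := by
  refine ⟨ShuffleWord.isMultiplicative_one, fun f g hf hg => hf.mul hg,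
    ShuffleWord.bijOn_genSeries, ?_⟩
  intro f g hf hg F G F₀ G₀ Ft Gt FG hF hG hFG hF₀ hG₀ hFt hGt
  have hconv : FG = ShuffleWord.seriesMk
      (ShuffleWord.convCoeff (ShuffleWord.entry f) (ShuffleWord.entry g) 0 0) := by
    rw [hFG]
    funext d
    exact hf.entry_mul hg (d 0) (d 1)
  rw [hF] at hF₀ hFt
  rw [hG] at hG₀ hGt
  rw [hconv]
  -- `genSeries f` and `seriesMk (entry f)` are equal by definition, so the hypotheses match as they
  -- stand.
  exact ShuffleWord.inverse_seriesMk_convCoeff hf.1 hg.1 hF₀ hG₀ hFt hGt
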